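/- A polytope is the convex hull of finitely many points in some $\mathbb{R}^d$. An extension of a polytope $P$ is a polytope $Q\subseteq\mathbb{R}^e$ (for some $e$) together with an affine map $\pi$ such that $\pi(Q)=P$. The extension complexity of $P$ is the minimum number of facets (faces of dimension $\dim Q-1$) of an extension $Q$ of $P$. For every integer $n\geq 4$, the bipartite matching polytope, i.e. the convex hull in $\mathbb{R}^{n\times n}$ of the characteristic vectors of all (not necessarily perfect) matchings of the complete bipartite graph $K_{n,n}$, has extension complexity exactly $n^2+2n$. -/

import Mathlib

/-- A polytope: the convex hull of finitely many points. -/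
def IsPolytope {E : Type*} [AddCommGroup E] [Module ℝ E] (Q : Set E) : Prop :=
  ∃ V : Set E, V.Finite ∧ Q = convexHull ℝ V

/-- The dimension of (the affine hull of) a nonempty set of points. -/
noncomputable def polyDim {E : Type*} [AddCommGroup E] [Module ℝ E] (Q : Set E) : ℕ :=
  Module.finrank ℝ (vectorSpan ℝ Q)

/-- A facet of `Q` is a nonempty face of dimension `dim Q - 1`. A nonempty face (an exposed
subset) is the set of all points of `Q` at which some linear functional attains its maximum
over `Q`. -/
def IsFacet {E : Type*} [AddCommGroup E] [Module ℝ E] [TopologicalSpace E] (Q F : Set E) : Prop :=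
  F.Nonempty ∧ IsExposed ℝ Q F ∧ polyDim F + 1 = polyDim Q

/-- The number of facets of `Q`. -/
noncomputable def numFacets {E : Type*} [AddCommGroup E] [Module ℝ E] [TopologicalSpace E]
    (Q : Set E) : ℕ∞ :=
  {F : Set E | IsFacet Q F}.encard

/-- A set `Q ⊆ ℝ^e` is an extension of `P` if it is a polytope and some affine map sends `Q`
onto `P`. -/
def IsExtension {E : Type*} [AddCommGroup E] [Module ℝ E] (P : Set E) {e : ℕ}
    (Q : Set (Fin e → ℝ)) : Prop :=
  IsPolytope Q ∧ ∃ π : (Fin e → ℝ) →ᵃ[ℝ] E, π '' Q = P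

/-- The extension complexity of `P`: the minimum number of facets of an extension of `P`, over all
dimensions `e`. (A nonempty infimum in `ℕ∞` is attained, and an infimum over nothing is `⊤`.) -/
noncomputable def extensionComplexity {E : Type*} [AddCommGroup E] [Module ℝ E] (P : Set E) : ℕ∞ :=
  sInf {r : ℕ∞ | ∃ (e : ℕ) (Q : Set (Fin e → ℝ)), IsExtension P Q ∧ numFacets Q = r}

open Classical in
/-- The characteristic vector of the edge set of a subgraph of `K_{n,n}`; the edge joining the
`i`-th vertex on the left to the `j`-th vertex on the right is indexed by `(i, j)`. -/
noncomputable def charVector {n : ℕ} (M : (completeBipartiteGraph (Fin n) (Fin n)).Subgraph) :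
    Fin n × Fin n → ℝ :=
  fun p => if M.Adj (Sum.inl p.1) (Sum.inr p.2) then 1 else 0

/-- The `n`-th bipartite matching polytope: the convex hull of the characteristic vectors of all
(not necessarily perfect) matchings of `K_{n,n}`. -/
noncomputable def bipartiteMatchingPolytope (n : ℕ) : Set (Fin n × Fin n → ℝ) :=
  convexHull ℝ {x | ∃ M : (completeBipartiteGraph (Fin n) (Fin n)).Subgraph,
    M.IsMatching ∧ x = charVector M}

/-! Upper bound: by Birkhoff's theorem the polytope is cut out by `n ^ 2 + 2 * n` inequalities, one
per edge and per vertex (the "tiles"), strict at some point, so its copy in `Fin (n * n) → ℝ` has at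
most that many facets (`numFacets_le_card`).

Lower bound: to a facet `F` of an extension attach the set `I` of tiles whose face has its preimage
inside `F`. Lift a matching to a point `q`. For each tile `t` with positive slack there, some facet
contains the preimage of the face of `t` and misses `q` (`exists_facet_of_face`); its `I` contains
`t` and lies in the slack support of the matching. Give every tile of `I` weight `1 / |I|`, so that
a facet spends at most 1. Each tile receives at least 1: there is a family of matchings whose
supports contain `t` and such that any `I` containing `t` lies in at most a `1 / |I|` fraction of
them. Hence there are at least as many facets as tiles. -/

section Polytope

/-! ### Facets of polytopes and polyhedra -/

variable {E : Type*} [NormedAddCommGroup E] [NormedSpace ℝ E]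

/-- The points of `Q` at which a linear functional attains its upper bound form an exposed face. -/
theorem isExposed_setOf_eq [FiniteDimensional ℝ E] {Q : Set E} {l : E →ₗ[ℝ] ℝ} {c : ℝ} (hle : ∀ x ∈ Q, l x ≤ c) :
    IsExposed ℝ Q {x ∈ Q | l x = c} := by
  rintro ⟨z, hz, hzc⟩
  refine ⟨LinearMap.toContinuousLinearMap l, ?_⟩
  ext x
  simp only [Set.mem_ofPred_eq, LinearMap.coe_toContinuousLinearMap']
  refine and_congr_right fun hx => ⟨fun h y hy => h ▸ hle y hy, fun h => ?_⟩
  exact le_antisymm (hle x hx) (hzc ▸ h z hz)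

theorem vectorSpan_le_ker {F : Set E} {l : E →ₗ[ℝ] ℝ} {c : ℝ} (h : ∀ x ∈ F, l x = c) :
    vectorSpan ℝ F ≤ LinearMap.ker l := by
  rw [vectorSpan, Submodule.span_le]
  rintro _ ⟨x, hx, y, hy, rfl⟩
  simp [h x hx, h y hy]

/-- A point of a set that is not on a hyperplane containing a subset enlarges the vector span. -/
theorem polyDim_lt_polyDim [FiniteDimensional ℝ E] {F Q : Set E} (hFQ : F ⊆ Q) {l : E →ₗ[ℝ] ℝ} {c : ℝ}
    (h : ∀ x ∈ F, l x = c) {f q : E} (hf : f ∈ F) (hq : q ∈ Q) (hqc : l q ≠ c) :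
    polyDim F < polyDim Q := by
  refine Submodule.finrank_lt_finrank_of_lt (lt_of_le_of_ne (vectorSpan_mono ℝ hFQ) fun he => ?_)
  have h1 : q - f ∈ vectorSpan ℝ F := he ▸ vsub_mem_vectorSpan ℝ hq (hFQ hf)
  have h2 := vectorSpan_le_ker h h1
  rw [LinearMap.mem_ker, map_sub, h f hf, sub_eq_zero] at h2
  exact hqc h2

theorem le_of_mem_convexHull {V : Set E} {l : E →ₗ[ℝ] ℝ} {c : ℝ} (h : ∀ x ∈ V, l x ≤ c) :
    ∀ x ∈ convexHull ℝ V, l x ≤ c := fun _ hx =>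
  convexHull_min (t := {x | l x ≤ c}) h (convex_halfSpace_le l.isLinear c) hx

/-- Rotating a supporting hyperplane about a face of codimension at least two, while keeping the
value at a given point off the face. -/
theorem exists_larger_face [FiniteDimensional ℝ E] {V : Set E} (hV : V.Finite) {l : E →ₗ[ℝ] ℝ} {c : ℝ}
    (hle : ∀ x ∈ convexHull ℝ V, l x ≤ c) {f q : E} (hf : f ∈ convexHull ℝ V) (hfc : l f = c)
    (hqc : l q < c)
    (hdim : polyDim {x ∈ convexHull ℝ V | l x = c} + 1 < polyDim (convexHull ℝ V)) :
    ∃ (l' : E →ₗ[ℝ] ℝ) (c' : ℝ), (∀ x ∈ convexHull ℝ V, l' x ≤ c') ∧ l' q < c' ∧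
      (∀ x ∈ convexHull ℝ V, l x = c → l' x = c') ∧
      ∃ v ∈ convexHull ℝ V, l' v = c' ∧ l v ≠ c := by
  set F := {x ∈ convexHull ℝ V | l x = c}
  have hfF : f ∈ F := ⟨hf, hfc⟩
  -- Since the face has codimension at least two, adding the direction `q - f` does not fill the
  -- whole direction space.
  obtain ⟨w, hw, hwU⟩ : ∃ w ∈ vectorSpan ℝ (convexHull ℝ V),
      w ∉ vectorSpan ℝ F ⊔ Submodule.span ℝ {q - f} := by
    by_contra! hcon
    have h1 := Submodule.finrank_mono (show vectorSpan ℝ (convexHull ℝ V) ≤ _ from hcon)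
    have h2 := Submodule.finrank_add_le_finrank_add_finrank (vectorSpan ℝ F)
      (Submodule.span ℝ {q - f})
    have h3 := finrank_span_le_card (R := ℝ) ({q - f} : Set E)
    simp only [Set.toFinset_singleton, Finset.card_singleton] at h3
    unfold polyDim at hdim
    omega
  obtain ⟨m₀, hm₀w, hm₀⟩ := Submodule.exists_le_ker_of_notMem hwU
  obtain ⟨m, hmU, v₀, hv₀, hmv₀⟩ : ∃ m : E →ₗ[ℝ] ℝ,
      vectorSpan ℝ F ⊔ Submodule.span ℝ {q - f} ≤ LinearMap.ker m ∧ ∃ v ∈ V, m f < m v := by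
    by_contra! hcon
    have h1 := le_of_mem_convexHull (hcon m₀ hm₀)
    have h2 := le_of_mem_convexHull (hcon (-m₀) (by
      intro x hx; simpa using hm₀ hx))
    refine hm₀w (vectorSpan_le_ker (c := m₀ f) (fun x hx => le_antisymm (h1 x hx) ?_) hw)
    simpa using h2 x hx
  have hmF : ∀ x ∈ F, m x = m f := fun x hx => by
    have := hmU (Submodule.mem_sup_left (vsub_mem_vectorSpan ℝ hx hfF))
    simpa [sub_eq_zero] using this
  have hmq : m q = m f := by
    have := hmU (Submodule.mem_sup_right (Submodule.mem_span_singleton_self (q - f)))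
    simpa [sub_eq_zero] using this
  -- Ratio test: the least ratio is the largest `t` for which `l + t • m` still supports the
  -- polytope, and its minimiser `v` becomes tight.
  obtain ⟨v, ⟨hv, hmv⟩, hmin⟩ := Set.exists_min_image {v ∈ V | m f < m v}
    (fun v => (c - l v) / (m v - m f)) (hV.subset (Set.sep_subset _ _)) ⟨v₀, hv₀, hmv₀⟩
  have hvQ := subset_convexHull ℝ V hv
  have hlv : l v ≠ c := fun h => hmv.ne' (hmF v ⟨hvQ, h⟩)
  set t := (c - l v) / (m v - m f) with ht
  have ht0 : 0 ≤ t := div_nonneg (sub_nonneg.2 (hle v hvQ)) (sub_pos.2 hmv).le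
  refine ⟨l + t • m, c + t * m f, le_of_mem_convexHull fun x hx => ?_, ?_, fun x hx hxc => ?_,
    v, hvQ, ?_, hlv⟩
  · simp only [LinearMap.add_apply, LinearMap.smul_apply, smul_eq_mul]
    have hlx := hle x (subset_convexHull ℝ V hx)
    rcases lt_or_ge (m f) (m x) with h | h
    · have := (le_div_iff₀ (sub_pos.2 h)).1 (hmin x ⟨hx, h⟩)
      linarith
    · have := mul_le_mul_of_nonneg_left h ht0
      linarith
  · simp [hmq, hqc]
  · simp [hxc, hmF x ⟨hx, hxc⟩]
  · have : t * (m v - m f) = c - l v := div_mul_cancel₀ _ (sub_pos.2 hmv).ne'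
    simp only [LinearMap.add_apply, LinearMap.smul_apply, smul_eq_mul]
    linarith

/-- A face of a polytope and a point of the polytope off that face are separated by a facet. -/
theorem exists_facet_of_face [FiniteDimensional ℝ E] {V : Set E} (hV : V.Finite) {f q : E} (hf : f ∈ convexHull ℝ V)
    (hq : q ∈ convexHull ℝ V) (l : E →ₗ[ℝ] ℝ) (c : ℝ) (hle : ∀ x ∈ convexHull ℝ V, l x ≤ c)
    (hfc : l f = c) (hqc : l q < c) :
    ∃ F, IsFacet (convexHull ℝ V) F ∧ {x ∈ convexHull ℝ V | l x = c} ⊆ F ∧ q ∉ F := by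
  induction hd : polyDim (convexHull ℝ V) - polyDim {x ∈ convexHull ℝ V | l x = c}
    using Nat.strong_induction_on generalizing l c with
  | _ d ih =>
    have hlt : polyDim {x ∈ convexHull ℝ V | l x = c} < polyDim (convexHull ℝ V) :=
      polyDim_lt_polyDim (Set.sep_subset _ _) (fun x hx => hx.2) ⟨hf, hfc⟩ hq hqc.ne
    rcases (Nat.succ_le_of_lt hlt).eq_or_lt with h | h
    · exact ⟨{x ∈ convexHull ℝ V | l x = c}, ⟨⟨f, hf, hfc⟩, isExposed_setOf_eq hle, h⟩,
        subset_rfl, fun h => hqc.ne h.2⟩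
    · obtain ⟨l', c', hle', hqc', hF, v, hv, hvc', hvc⟩ :=
        exists_larger_face hV hle hf hfc hqc h
      have hsub : {x ∈ convexHull ℝ V | l x = c} ⊆ {x ∈ convexHull ℝ V | l' x = c'} :=
        fun x hx => ⟨hx.1, hF x hx.1 hx.2⟩
      have h2 := polyDim_lt_polyDim hsub (fun x hx => hx.2) ⟨hf, hfc⟩ ⟨hv, hvc'⟩ hvc
      obtain ⟨G, hG, hsG, hqG⟩ := ih _ (by omega) l' c' hle' (hF f hf hfc) hqc' rfl
      exact ⟨G, hG, hsub.trans hsG, hqG⟩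

/-- A polyhedron with a strictly feasible point has at most as many facets as there are inequalities
describing it. -/
theorem numFacets_le_card [FiniteDimensional ℝ E] {T : Type*} [Fintype T] (s : T → E →ᵃ[ℝ] ℝ) {x₀ : E}
    (hx₀ : ∀ t, 0 < s t x₀) : numFacets {x | ∀ t, 0 ≤ s t x} ≤ Fintype.card T := by
  set Q := {x | ∀ t, 0 ≤ s t x}
  have hs : ∀ t (x y : E), (s t).linear (x - y) = s t x - s t y := fun t x y =>
    (s t).linearMap_vsub x y
  have key : {F | IsFacet Q F} ⊆ Set.range fun t => {x ∈ Q | s t x = 0} := by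
    rintro F ⟨hne, hexp, hdim⟩
    obtain ⟨l, hl⟩ := hexp hne
    have hFQ : F ⊆ Q := fun x hx => by rw [hl] at hx; exact hx.1
    have hQF : ∃ q ∈ Q, q ∉ F := by
      by_contra! h
      rw [subset_antisymm hFQ h] at hdim
      omega
    -- Otherwise averaging gives `y ∈ F` with all inequalities strict, and the segment from `q ∉ F`
    -- can be prolonged past `y` inside `Q`, raising `l` above its maximum.
    obtain ⟨t, ht⟩ : ∃ t, ∀ x ∈ F, s t x = 0 := by
      by_contra! hcon
      choose p hp hp0 using hcon
      have hFc : Convex ℝ F := hexp.convex (show Convex ℝ Q by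
        intro x hx y hy a b ha hb hab t
        rw [Convex.combo_affine_apply hab]
        exact add_nonneg (mul_nonneg ha (hx t)) (mul_nonneg hb (hy t)))
      have hpos : ∀ S : Finset T, ∃ y ∈ F, ∀ t ∈ S, 0 < s t y := by
        classical
        intro S
        induction S using Finset.induction_on with
        | empty => exact hne.imp fun y hy => ⟨hy, by simp⟩
        | insert a S _ ih =>
          obtain ⟨y, hy, hyS⟩ := ih
          refine ⟨(1 / 2 : ℝ) • y + (1 / 2 : ℝ) • p a,
            hFc hy (hp a) (by norm_num) (by norm_num) (by norm_num), fun t ht => ?_⟩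
          rw [Convex.combo_affine_apply (by norm_num), smul_eq_mul, smul_eq_mul]
          have h1 := hFQ hy t
          have h2 := hFQ (hp a) t
          rcases Finset.mem_insert.1 ht with rfl | h
          · have := lt_of_le_of_ne h2 (hp0 t).symm
            linarith
          · have := hyS t h
            linarith
      obtain ⟨y, hy, hyT⟩ := hpos Finset.univ
      obtain ⟨q, hq, hqF⟩ := hQF
      have hyl : ∀ z ∈ Q, l z ≤ l y := by
        rw [hl] at hy
        exact hy.2
      have hlq : l q < l y := by
        refine lt_of_le_of_ne (hyl q hq) fun h => hqF ?_
        rw [hl]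
        exact ⟨hq, fun z hz => h ▸ hyl z hz⟩
      have hev : ∀ᶠ r : ℝ in nhdsWithin 1 (Set.Ioi 1), ∀ t, 0 < s t (AffineMap.lineMap q y r) := by
        refine Filter.eventually_all.2 fun t => nhdsWithin_le_nhds ?_
        have hc : Continuous fun r : ℝ => s t (AffineMap.lineMap q y r) :=
          ((s t).comp (AffineMap.lineMap q y)).continuous_of_finiteDimensional
        exact hc.continuousAt.eventually_const_lt (by simpa using hyT t (Finset.mem_univ t))
      obtain ⟨r, hr, hr1⟩ := (hev.and self_mem_nhdsWithin).exists
      have hz := hyl _ fun t => (hr t).le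
      simp only [AffineMap.lineMap_apply, vsub_eq_sub, vadd_eq_add, map_add, map_smul, map_sub,
        smul_eq_mul] at hz
      have := mul_lt_mul_of_pos_right (Set.mem_Ioi.1 hr1) (sub_pos.2 hlq)
      linarith
    refine ⟨t, subset_antisymm ?_ fun x hx => ⟨hFQ hx, ht x hx⟩⟩
    obtain ⟨f, hf⟩ := hne
    have hFt : F ⊆ {x ∈ Q | s t x = 0} := fun x hx => ⟨hFQ hx, ht x hx⟩
    have hlin : ∀ x, (s t).linear x = s t x - s t 0 := fun x => by rw [← hs, sub_zero]
    have hlt : polyDim {x ∈ Q | s t x = 0} < polyDim Q :=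
      polyDim_lt_polyDim (l := (s t).linear) (c := - s t 0) (Set.sep_subset _ _)
        (fun x hx => by rw [hlin, hx.2, zero_sub]) (hFt hf) (fun t => (hx₀ t).le)
        (by rw [hlin]; have := hx₀ t; intro h; linarith)
    -- The face `s t = 0` is proper and contains the codimension-one `F`, so both have the same
    -- directions and `l` is constant on it.
    have hspan : vectorSpan ℝ F = vectorSpan ℝ {x ∈ Q | s t x = 0} :=
      Submodule.eq_of_le_of_finrank_le (vectorSpan_mono ℝ hFt)
        (Nat.le_of_lt_succ (hlt.trans_eq hdim.symm))
    have hlF : ∀ x ∈ F, (l : E →ₗ[ℝ] ℝ) x = l f := fun x hx => by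
      rw [hl] at hx hf
      exact le_antisymm (hf.2 x hx.1) (hx.2 f hf.1)
    intro x hx
    have h1 : x - f ∈ vectorSpan ℝ F := hspan ▸ vsub_mem_vectorSpan ℝ hx (hFt hf)
    have h2 := vectorSpan_le_ker hlF h1
    rw [LinearMap.mem_ker, map_sub, sub_eq_zero] at h2
    rw [hl] at hf ⊢
    exact ⟨hx.1, fun z hz => (hf.2 z hz).trans_eq h2.symm⟩
  calc numFacets Q ≤ (Set.range fun t => {x ∈ Q | s t x = 0}).encard := Set.encard_le_encard key
    _ ≤ (Set.univ : Set T).encard := by rw [← Set.image_univ]; exact Set.encard_image_le _ _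
    _ = Fintype.card T := by simp [Set.encard_univ]

end Polytope

/-! ### Inequality description and the upper bound -/

/-- Indices of the inequalities of the bipartite matching polytope: edges, left and right vertices. -/
abbrev MatchingTile (n : ℕ) : Type := (Fin n × Fin n) ⊕ (Fin n ⊕ Fin n)

/-- The functional whose value at the characteristic vector of a matching indicates whether an edge
belongs to the matching, respectively whether a vertex is uncovered. -/
noncomputable def matchingSlack {n : ℕ} : MatchingTile n → (Fin n × Fin n → ℝ) →ᵃ[ℝ] ℝ
  | .inl p => (LinearMap.proj p : (Fin n × Fin n → ℝ) →ₗ[ℝ] ℝ).toAffineMap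
  | .inr (.inl i) => AffineMap.const ℝ _ 1 -
      (∑ j, LinearMap.proj (i, j) : (Fin n × Fin n → ℝ) →ₗ[ℝ] ℝ).toAffineMap
  | .inr (.inr j) => AffineMap.const ℝ _ 1 -
      (∑ i, LinearMap.proj (i, j) : (Fin n × Fin n → ℝ) →ₗ[ℝ] ℝ).toAffineMap

@[simp]
theorem matchingSlack_edge {n : ℕ} (p : Fin n × Fin n) (x : Fin n × Fin n → ℝ) :
    matchingSlack (.inl p) x = x p := rfl

@[simp]
theorem matchingSlack_left {n : ℕ} (i : Fin n) (x : Fin n × Fin n → ℝ) :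
    matchingSlack (.inr (.inl i)) x = 1 - ∑ j, x (i, j) := by
  simp [matchingSlack]

@[simp]
theorem matchingSlack_right {n : ℕ} (j : Fin n) (x : Fin n × Fin n → ℝ) :
    matchingSlack (.inr (.inr j)) x = 1 - ∑ i, x (i, j) := by
  simp [matchingSlack]

theorem matchingSlack_charVector_nonneg {n : ℕ}
    {M : (completeBipartiteGraph (Fin n) (Fin n)).Subgraph} (hM : M.IsMatching)
    (t : MatchingTile n) : 0 ≤ matchingSlack t (charVector M) := by
  classical
  rcases t with p | i | j
  · rw [matchingSlack_edge, charVector]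
    positivity
  · simp only [matchingSlack_left, charVector, Finset.sum_boole, sub_nonneg]
    exact_mod_cast Finset.card_le_one.2 fun a ha b hb => Sum.inr_injective
      (hM.eq_of_adj_left (Finset.mem_filter.1 ha).2 (Finset.mem_filter.1 hb).2)
  · simp only [matchingSlack_right, charVector, Finset.sum_boole, sub_nonneg]
    exact_mod_cast Finset.card_le_one.2 fun a ha b hb => Sum.inl_injective
      (hM.eq_of_adj_right (Finset.mem_filter.1 ha).2 (Finset.mem_filter.1 hb).2)

open Classical in
/-- The indicator vector of a partial injection is the characteristic vector of a matching. -/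
theorem exists_isMatching_charVector_eq {n : ℕ} (R : Fin n → Fin n → Prop)
    (hl : ∀ i j j', R i j → R i j' → j = j') (hr : ∀ i i' j, R i j → R i' j → i = i') :
    ∃ M : (completeBipartiteGraph (Fin n) (Fin n)).Subgraph,
      M.IsMatching ∧ (fun p => if R p.1 p.2 then 1 else 0) = charVector M := by
  let A : Fin n ⊕ Fin n → Fin n ⊕ Fin n → Prop
    | .inl i, .inr j => R i j
    | .inr j, .inl i => R i j
    | _, _ => False
  refine ⟨{ verts := {v | ∃ w, A v w}, Adj := A, adj_sub := ?_, edge_vert := ?_, symm := ?_ },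
    ?_, ?_⟩
  · rintro (i | i) (j | j) h <;> simp_all [A]
  · exact fun h => ⟨_, h⟩
  · refine ⟨?_⟩
    rintro (i | i) (j | j) h <;> simp_all [A]
  · rintro v ⟨w, h⟩
    refine ⟨w, h, fun w' h' => ?_⟩
    change A v w' at h'
    rcases v with v | v <;> rcases w with w | w <;> rcases w' with w' | w' <;> simp only [A] at h h'
    · rw [hl _ _ _ h h']
    · rw [hr _ _ _ h h']
  · rfl

theorem bipartiteMatchingPolytope_eq (n : ℕ) :
    bipartiteMatchingPolytope n = {x | ∀ t, 0 ≤ matchingSlack t x} := by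
  classical
  refine subset_antisymm (convexHull_min ?_ ?_) fun x hx => ?_
  · rintro _ ⟨M, hM, rfl⟩
    exact matchingSlack_charVector_nonneg hM
  · intro x hx y hy a b ha hb hab t
    rw [Convex.combo_affine_apply hab]
    exact add_nonneg (mul_nonneg ha (hx t)) (mul_nonneg hb (hy t))
  · have h0 : ∀ i j, 0 ≤ x (i, j) := fun i j => by simpa using hx (.inl (i, j))
    have hl : ∀ i, ∑ j, x (i, j) ≤ 1 := fun i => by simpa using hx (.inr (.inl i))
    have hr : ∀ j, ∑ i, x (i, j) ≤ 1 := fun j => by simpa using hx (.inr (.inr j))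
    -- Put the vertex slacks on the diagonals of the off-diagonal blocks to get a doubly stochastic
    -- matrix; the upper left block of a permutation matrix is a matching.
    let B : Matrix (Fin n ⊕ Fin n) (Fin n ⊕ Fin n) ℝ :=
      Matrix.fromBlocks (Matrix.of fun i j => x (i, j))
        (Matrix.diagonal fun i => 1 - ∑ j, x (i, j))
        (Matrix.diagonal fun j => 1 - ∑ i, x (i, j)) (Matrix.of fun j i => x (i, j))
    have hB : B ∈ doublyStochastic ℝ (Fin n ⊕ Fin n) := by
      rw [mem_doublyStochastic_iff_sum]
      refine ⟨?_, ?_, ?_⟩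
      · rintro (i | i) (j | j)
        · exact h0 i j
        · simp only [B, Matrix.fromBlocks_apply₁₂, Matrix.diagonal_apply]
          split_ifs
          exacts [sub_nonneg.2 (hl i), le_rfl]
        · simp only [B, Matrix.fromBlocks_apply₂₁, Matrix.diagonal_apply]
          split_ifs
          exacts [sub_nonneg.2 (hr i), le_rfl]
        · exact h0 j i
      · rintro (i | i) <;> simp [B, Matrix.diagonal_apply]
      · rintro (i | i) <;> simp [B, Matrix.diagonal_apply]
    rw [← SetLike.mem_coe, doublyStochastic_eq_convexHull_permMatrix] at hB
    let L : Matrix (Fin n ⊕ Fin n) (Fin n ⊕ Fin n) ℝ →ₗ[ℝ] (Fin n × Fin n → ℝ) :=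
      { toFun := fun C p => C (.inl p.1) (.inl p.2)
        map_add' := fun _ _ => rfl
        map_smul' := fun _ _ => rfl }
    have hx' : x ∈ L '' convexHull ℝ {σ.permMatrix ℝ | σ : Equiv.Perm (Fin n ⊕ Fin n)} :=
      ⟨B, hB, rfl⟩
    rw [LinearMap.image_convexHull] at hx'
    refine convexHull_mono ?_ hx'
    rintro _ ⟨_, ⟨σ, rfl⟩, rfl⟩
    obtain ⟨M, hM, h⟩ := exists_isMatching_charVector_eq (fun i j => σ (.inl i) = .inl j)
      (fun i j j' h h' => Sum.inl_injective (h.symm.trans h'))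
      (fun i i' j h h' => Sum.inl_injective (σ.injective (h.trans h'.symm)))
    refine ⟨M, hM, h ▸ ?_⟩
    ext p
    change (σ.permMatrix ℝ) (.inl p.1) (.inl p.2) = _
    simp [Equiv.Perm.permMatrix, PEquiv.toMatrix_apply, eq_comm]

theorem isPolytope_bipartiteMatchingPolytope (n : ℕ) : IsPolytope (bipartiteMatchingPolytope n) := by
  refine ⟨_, ?_, rfl⟩
  refine (Set.Finite.pi' (fun _ : Fin n × Fin n => Set.toFinite ({0, 1} : Set ℝ))).subset ?_
  rintro _ ⟨M, -, rfl⟩ p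
  unfold charVector
  split_ifs <;> simp

theorem extensionComplexity_bipartiteMatchingPolytope_le (n : ℕ) :
    extensionComplexity (bipartiteMatchingPolytope n) ≤ ((n ^ 2 + 2 * n : ℕ) : ℕ∞) := by
  let e : (Fin n × Fin n → ℝ) ≃ₗ[ℝ] (Fin (n * n) → ℝ) :=
    LinearEquiv.funCongrLeft ℝ ℝ finProdFinEquiv.symm
  let s : MatchingTile n → (Fin (n * n) → ℝ) →ᵃ[ℝ] ℝ := fun t =>
    (matchingSlack t).comp (e.symm : (Fin (n * n) → ℝ) →ₗ[ℝ] (Fin n × Fin n → ℝ)).toAffineMap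
  have hQ : e '' bipartiteMatchingPolytope n = {y | ∀ t, 0 ≤ s t y} := by
    rw [LinearEquiv.image_eq_preimage_symm, bipartiteMatchingPolytope_eq]
    rfl
  have hpos : ∀ t, 0 < s t (e fun _ => 1 / (n + 1 : ℝ)) := by
    have h : (0 : ℝ) < 1 - n / (n + 1) := by
      rw [sub_pos, div_lt_one (by positivity)]
      linarith
    rintro (p | i | j)
    · simp only [s, AffineMap.comp_apply, LinearMap.coe_toAffineMap, LinearEquiv.coe_coe,
        LinearEquiv.symm_apply_apply, matchingSlack_edge]
      positivity
    · simpa [s, div_eq_mul_inv] using h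
    · simpa [s, div_eq_mul_inv] using h
  have hcard : numFacets (e '' bipartiteMatchingPolytope n) ≤ ((n ^ 2 + 2 * n : ℕ) : ℕ∞) := by
    rw [hQ]
    refine (numFacets_le_card s hpos).trans_eq ?_
    simp [MatchingTile]
    ring_nf
  refine le_trans (sInf_le ⟨n * n, e '' bipartiteMatchingPolytope n, ⟨?_, ?_⟩, rfl⟩) hcard
  · obtain ⟨V, hV, h⟩ := isPolytope_bipartiteMatchingPolytope n
    exact ⟨e '' V, hV.image _, by
      rw [h]; exact (e : (Fin n × Fin n → ℝ) →ₗ[ℝ] (Fin (n * n) → ℝ)).image_convexHull V⟩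
  · refine ⟨(e.symm : (Fin (n * n) → ℝ) →ₗ[ℝ] (Fin n × Fin n → ℝ)).toAffineMap, ?_⟩
    simp [Set.image_image]

/-! ### Weighted counting -/

section Counting

variable {α T : Type*} [DecidableEq T]

/-- If `t` lies in every member of a uniform family of `K`-sets and any other element lies in at most
a `1 / (K - 1)` fraction of them, then a set `I` is contained in at most a `1 / |I|`
fraction of them. -/
theorem card_mul_card_filter_subset_le {A : Finset α} {f : α → Finset T} (hinj : Set.InjOn f A)
    {K : ℕ} (hK : ∀ a ∈ A, (f a).card = K) (hKA : K ≤ A.card) {t : T}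
    (hp : ∀ t' ≠ t, (K - 1) * (A.filter fun a => t' ∈ f a).card ≤ A.card)
    (I : Finset T) : I.card * (A.filter fun a => I ⊆ f a).card ≤ A.card := by
  rcases lt_or_ge I.card K with hIK | hIK
  -- A small `I` with two elements has some `t' ≠ t`, and `|I| ≤ K - 1`. A large `I` can only equal
  -- a single member of the family, and `K ≤ |A|`.
  · rcases lt_or_ge 1 I.card with h1 | h1
    · obtain ⟨t', ht', hne⟩ := Finset.exists_mem_ne h1 t
      refine le_trans (Nat.mul_le_mul (Nat.le_sub_one_of_lt hIK) (Finset.card_le_card ?_)) (hp t' hne)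
      exact Finset.monotone_filter_right _ fun a _ h => h ht'
    · calc _ ≤ 1 * A.card := Nat.mul_le_mul h1 (Finset.card_filter_le _ _)
        _ = A.card := one_mul _
  · rcases (A.filter fun a => I ⊆ f a).eq_empty_or_nonempty with h | ⟨a, ha⟩
    · simp [h]
    · have heq : ∀ b ∈ A.filter (fun a => I ⊆ f a), I = f b := fun b hb => by
        rw [Finset.mem_filter] at hb
        exact Finset.eq_of_subset_of_card_le hb.2 (by rw [hK b hb.1]; exact hIK)
      have hone : (A.filter fun a => I ⊆ f a).card ≤ 1 :=
        Finset.card_le_one.2 fun b hb c hc => hinj (Finset.mem_filter.1 hb).1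
          (Finset.mem_filter.1 hc).1 ((heq b hb).symm.trans (heq c hc))
      have hI : I.card = K := by rw [heq a ha, hK a (Finset.mem_filter.1 ha).1]
      calc _ ≤ K * 1 := Nat.mul_le_mul hI.le hone
        _ ≤ A.card := by omega

/-- Union bound: the sets `I k` containing `t` cover the family, and each accounts for at most `|A|
/ |I k|` members. -/
theorem one_le_sum_inv_card {ι : Type*} [Fintype ι] (I : ι → Finset T) {A : Finset α}
    (hA : A.Nonempty) {f : α → Finset T} {t : T}
    (hcard : ∀ k, (I k).card * (A.filter fun a => I k ⊆ f a).card ≤ A.card)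
    (hcov : ∀ a ∈ A, ∃ k, t ∈ I k ∧ I k ⊆ f a) :
    1 ≤ ∑ k, if t ∈ I k then ((I k).card : ℝ)⁻¹ else 0 := by
  classical
  have hA0 : (0 : ℝ) < A.card := by exact_mod_cast hA.card_pos
  have h1 : A.card ≤ ∑ k with t ∈ I k, (A.filter fun a => I k ⊆ f a).card := by
    refine le_trans (Finset.card_le_card fun a ha => ?_) Finset.card_biUnion_le
    obtain ⟨k, hk, hka⟩ := hcov a ha
    simp only [Finset.mem_biUnion, Finset.mem_filter, Finset.mem_univ, true_and]
    exact ⟨k, hk, ha, hka⟩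
  rw [← Finset.sum_filter, ← mul_le_mul_iff_right₀ hA0, mul_one, Finset.mul_sum]
  refine le_trans (by exact_mod_cast h1) ((Nat.cast_sum _ _).trans_le (Finset.sum_le_sum fun k hk => ?_))
  have htk := (Finset.mem_filter.1 hk).2
  have h0 : (0 : ℝ) < (I k).card := by exact_mod_cast Finset.card_pos.2 ⟨t, htk⟩
  rw [← div_eq_mul_inv, le_div_iff₀ h0, mul_comm]
  exact_mod_cast hcard k

/-- Double counting: each `I k` distributes total weight at most 1. -/
theorem card_le_card_of_one_le_sum_inv_card {ι : Type*} [Fintype ι] [Fintype T]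
    (I : ι → Finset T) (h : ∀ t, 1 ≤ ∑ k, if t ∈ I k then ((I k).card : ℝ)⁻¹ else 0) :
    Fintype.card T ≤ Fintype.card ι := by
  have h1 : (Fintype.card T : ℝ) ≤ Fintype.card ι := by
    calc (Fintype.card T : ℝ) = ∑ _t : T, 1 := by simp
      _ ≤ ∑ t, ∑ k, if t ∈ I k then ((I k).card : ℝ)⁻¹ else 0 := Finset.sum_le_sum fun t _ => h t
      _ = ∑ k, ∑ t, if t ∈ I k then ((I k).card : ℝ)⁻¹ else 0 := Finset.sum_comm
      _ ≤ ∑ _k : ι, 1 := Finset.sum_le_sum fun k _ => by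
          rw [← Finset.sum_filter, Finset.sum_const, nsmul_eq_mul, Finset.filter_mem_eq_inter,
            Finset.univ_inter]
          exact mul_inv_le_one
      _ = Fintype.card ι := by simp
  exact_mod_cast h1

end Counting

/-! ### Families of matchings obtained from permutations -/

section Perm

variable {n : ℕ}

theorem card_filter_perm_apply_le (i j j' : Fin n) :
    (Finset.univ.filter fun σ : Equiv.Perm (Fin n) => σ i = j).card ≤
      (Finset.univ.filter fun σ : Equiv.Perm (Fin n) => σ i = j').card :=
  Finset.card_le_card_of_injOn (fun σ => Equiv.swap j j' * σ) (fun σ hσ => by simp_all)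
    (mul_right_injective _).injOn

theorem mul_card_filter_perm_apply (i j : Fin n) :
    n * (Finset.univ.filter fun σ : Equiv.Perm (Fin n) => σ i = j).card = n.factorial := by
  have h := Finset.card_eq_sum_card_fiberwise (s := Finset.univ) (t := Finset.univ)
    (f := fun σ : Equiv.Perm (Fin n) => σ i) (fun _ _ => Finset.mem_coe.2 (Finset.mem_univ _))
  rw [Finset.sum_congr rfl fun j' _ => le_antisymm (card_filter_perm_apply_le i j' j)
    (card_filter_perm_apply_le i j j')] at h
  simpa [Fintype.card_perm] using h.symm

theorem pred_mul_card_filter_perm_apply_le {u i w j : Fin n} (hi : i ≠ u) (hj : j ≠ w) :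
    (n - 1) * (Finset.univ.filter fun σ : Equiv.Perm (Fin n) => σ u = w ∧ σ i = j).card ≤
      (Finset.univ.filter fun σ : Equiv.Perm (Fin n) => σ u = w).card := by
  have h := Finset.card_eq_sum_card_fiberwise
    (s := Finset.univ.filter fun σ : Equiv.Perm (Fin n) => σ u = w) (t := Finset.univ.erase w)
    (f := fun σ : Equiv.Perm (Fin n) => σ i) (fun σ hσ => by
      have := σ.injective.ne hi
      simp_all)
  rw [h]
  refine le_trans (le_of_eq ?_) (Finset.card_nsmul_le_sum _ _
    (Finset.univ.filter fun σ : Equiv.Perm (Fin n) => σ u = w ∧ σ i = j).card fun j' hj' => ?_)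
  · simp
  · rw [Finset.filter_filter]
    -- The swap fixes `w`, so it preserves the condition `σ u = w`.
    refine Finset.card_le_card_of_injOn (fun σ => Equiv.swap j j' * σ) (fun σ hσ => ?_)
      (mul_right_injective _).injOn
    have h1 := (Finset.mem_erase.1 hj').1
    simp only [Finset.coe_filter, Finset.mem_univ, true_and, Set.mem_ofPred_eq] at hσ ⊢
    simp [hσ.1, hσ.2, Equiv.swap_apply_of_ne_of_ne hj.symm h1.symm]

/-- The edges and uncovered vertices of the matching obtained from the perfect matching `σ` by
deleting the edges at the left vertices in `S`. -/
def matchingTiles (σ : Equiv.Perm (Fin n)) (S : Finset (Fin n)) : Finset (MatchingTile n) :=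
  (Sᶜ.image fun i => (i, σ i)).disjSum (S.disjSum (S.image σ))

@[simp]
theorem edge_mem_matchingTiles {σ : Equiv.Perm (Fin n)} {S : Finset (Fin n)} {p : Fin n × Fin n} :
    .inl p ∈ matchingTiles σ S ↔ p.1 ∉ S ∧ σ p.1 = p.2 := by
  obtain ⟨i, j⟩ := p
  simp [matchingTiles]

@[simp]
theorem left_mem_matchingTiles {σ : Equiv.Perm (Fin n)} {S : Finset (Fin n)} {i : Fin n} :
    .inr (.inl i) ∈ matchingTiles σ S ↔ i ∈ S := by
  simp [matchingTiles]

@[simp]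
theorem right_mem_matchingTiles {σ : Equiv.Perm (Fin n)} {S : Finset (Fin n)} {j : Fin n} :
    .inr (.inr j) ∈ matchingTiles σ S ↔ σ.symm j ∈ S := by
  simp [matchingTiles, ← Equiv.eq_symm_apply]

theorem card_matchingTiles (σ : Equiv.Perm (Fin n)) (S : Finset (Fin n)) :
    (matchingTiles σ S).card = n + S.card := by
  rw [matchingTiles, Finset.card_disjSum, Finset.card_disjSum,
    Finset.card_image_of_injective _ fun a b h => congrArg Prod.fst h,
    Finset.card_image_of_injective _ σ.injective, Finset.card_compl, Fintype.card_fin]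
  have := S.card_le_univ
  rw [Fintype.card_fin] at this
  omega

/-- With at most one edge deleted, its ends are recovered as the two uncovered vertices; with more,
their pairing would be lost. -/
theorem eq_of_matchingTiles_eq {σ σ' : Equiv.Perm (Fin n)} {S S' : Finset (Fin n)}
    (hS : S.card ≤ 1) (h : matchingTiles σ S = matchingTiles σ' S') : σ = σ' := by
  have hSS : S = S' := by
    ext i
    rw [← left_mem_matchingTiles (σ := σ), h, left_mem_matchingTiles]
  subst hSS
  ext1 i
  by_cases hi : i ∈ S
  · have h1 : (.inr (.inr (σ i)) : MatchingTile n) ∈ matchingTiles σ' S := by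
      rw [← h]; simpa using hi
    rw [right_mem_matchingTiles] at h1
    exact ((Equiv.symm_apply_eq _).1 (Finset.card_le_one.1 hS _ h1 _ hi))
  · have h1 : (.inl (i, σ i) : MatchingTile n) ∈ matchingTiles σ' S := by
      rw [← h]; simpa using hi
    exact ((edge_mem_matchingTiles.1 h1).2).symm

/-- The set `matchingTiles σ S` is the support of the slack vector of a point of the polytope. -/
theorem exists_matchingSlack_eq (σ : Equiv.Perm (Fin n)) (S : Finset (Fin n)) :
    ∃ x ∈ bipartiteMatchingPolytope n,
      ∀ t, matchingSlack t x = if t ∈ matchingTiles σ S then 1 else 0 := by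
  have key : ∀ t, matchingSlack t (fun p => if p.1 ∉ S ∧ σ p.1 = p.2 then (1 : ℝ) else 0) =
      if t ∈ matchingTiles σ S then 1 else 0 := by
    rintro (p | i | j)
    · simp
    · by_cases h : i ∈ S <;> simp [h]
    · have hiff : ∀ i, (i ∉ S ∧ σ i = j) ↔ (i = σ.symm j ∧ σ.symm j ∉ S) := fun i => by
        rw [← Equiv.eq_symm_apply, and_comm]
        exact and_congr_right fun h => by rw [h]
      by_cases h : σ.symm j ∈ S <;> simp [hiff, h]
  refine ⟨_, ?_, key⟩
  rw [bipartiteMatchingPolytope_eq]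
  intro t
  rw [key]
  split_ifs <;> norm_num

/-- The family is all perfect matchings with one edge deleted, so `K = n + 1`. Another tile forces
some `σ i = j`, which holds for a `1 / n` fraction of permutations. -/
theorem one_le_sum_inv_card_of_vertex (hn : 4 ≤ n) {ι : Type*} [Fintype ι]
    (I : ι → Finset (MatchingTile n))
    (hI : ∀ σ S, ∀ t ∈ matchingTiles σ S, ∃ k, t ∈ I k ∧ I k ⊆ matchingTiles σ S)
    (t : MatchingTile n) (s : Equiv.Perm (Fin n) → Fin n) (ht : ∀ σ, t ∈ matchingTiles σ {s σ})
    (hs : ∀ t' ≠ t, ∃ i j, ∀ σ, t' ∈ matchingTiles σ {s σ} → σ i = j) :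
    1 ≤ ∑ k, if t ∈ I k then ((I k).card : ℝ)⁻¹ else 0 := by
  have hcard : (Finset.univ : Finset (Equiv.Perm (Fin n))).card = n.factorial := by
    simp [Fintype.card_perm]
  refine one_le_sum_inv_card I Finset.univ_nonempty (f := fun σ => matchingTiles σ {s σ})
    (fun k => card_mul_card_filter_subset_le (t := t) (K := n + 1)
      (fun σ _ σ' _ h => eq_of_matchingTiles_eq (by simp) h) (fun σ _ => by
        simp [card_matchingTiles]) ?_ (fun t' ht' => ?_) (I k)) fun σ _ => hI σ _ t (ht σ)
  · rw [hcard]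
    exact Nat.lt_factorial_self (by omega)
  · obtain ⟨i, j, hij⟩ := hs t' ht'
    rw [hcard, Nat.add_sub_cancel, ← mul_card_filter_perm_apply i j]
    exact Nat.mul_le_mul_left _ (Finset.card_le_card
      (Finset.monotone_filter_right _ fun σ _ h => hij σ h))

/-- The family is the perfect matchings through `(u, w)`, so `K = n`; any other edge lies in at most
a `1 / (n - 1)` fraction of them. -/
theorem one_le_sum_inv_card_of_edge (hn : 4 ≤ n) {ι : Type*} [Fintype ι]
    (I : ι → Finset (MatchingTile n))
    (hI : ∀ σ S, ∀ t ∈ matchingTiles σ S, ∃ k, t ∈ I k ∧ I k ⊆ matchingTiles σ S)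
    (u w : Fin n) :
    1 ≤ ∑ k, if (.inl (u, w) : MatchingTile n) ∈ I k then ((I k).card : ℝ)⁻¹ else 0 := by
  set A := Finset.univ.filter fun σ : Equiv.Perm (Fin n) => σ u = w with hA
  refine one_le_sum_inv_card I (A := A) ⟨Equiv.swap u w, by simp [hA]⟩
    (f := fun σ => matchingTiles σ ∅)
    (fun k => card_mul_card_filter_subset_le (t := .inl (u, w)) (K := n)
      (fun σ _ σ' _ h => eq_of_matchingTiles_eq (by simp) h) (fun σ _ => by
        simp [card_matchingTiles]) ?_ (fun t' ht' => ?_) (I k))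
    fun σ hσ => hI σ _ _ (by simpa using (Finset.mem_filter.1 hσ).2)
  -- The requirement `K ≤ |A|` reads `n ≤ (n - 1)!`, which fails for `n = 3`.
  · obtain ⟨m, rfl⟩ : ∃ m, n = m + 1 := ⟨n - 1, by omega⟩
    have h := mul_card_filter_perm_apply u w
    rw [Nat.factorial_succ] at h
    rw [hA, Nat.eq_of_mul_eq_mul_left m.succ_pos h]
    exact Nat.lt_factorial_self (by omega)
  · rcases t' with ⟨i, j⟩ | i | j
    · by_cases hi : i = u
      · subst hi
        have hj : j ≠ w := fun h => ht' (by rw [h])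
        rw [Finset.filter_eq_empty_iff.2]
        · simp
        · intro σ hσ h
          exact hj ((edge_mem_matchingTiles.1 h).2.symm.trans (Finset.mem_filter.1 hσ).2)
      · by_cases hj : j = w
        · subst hj
          rw [Finset.filter_eq_empty_iff.2]
          · simp
          · intro σ hσ h
            exact hi (σ.injective
              ((edge_mem_matchingTiles.1 h).2.trans (Finset.mem_filter.1 hσ).2.symm))
        · simpa [hA, Finset.filter_filter] using pred_mul_card_filter_perm_apply_le hi hj
    · simp
    · simp

theorem card_matchingTile_le (hn : 4 ≤ n) {ι : Type*} [Fintype ι]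
    (I : ι → Finset (MatchingTile n))
    (hI : ∀ σ S, ∀ t ∈ matchingTiles σ S, ∃ k, t ∈ I k ∧ I k ⊆ matchingTiles σ S) :
    Fintype.card (MatchingTile n) ≤ Fintype.card ι := by
  refine card_le_card_of_one_le_sum_inv_card I ?_
  rintro (⟨u, w⟩ | u | w)
  · exact one_le_sum_inv_card_of_edge hn I hI u w
  · refine one_le_sum_inv_card_of_vertex hn I hI _ (fun _ => u) (by simp) ?_
    rintro (⟨i, j⟩ | i | j) h
    · exact ⟨i, j, fun σ hσ => (edge_mem_matchingTiles.1 hσ).2⟩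
    · exact ⟨i, i, fun σ hσ => absurd hσ (by simpa using h)⟩
    · exact ⟨u, j, fun σ hσ => by
        rw [right_mem_matchingTiles, Finset.mem_singleton] at hσ
        exact ((Equiv.symm_apply_eq σ).1 hσ).symm⟩
  · refine one_le_sum_inv_card_of_vertex hn I hI _ (fun σ => σ.symm w) (by simp) ?_
    rintro (⟨i, j⟩ | i | j) h
    · exact ⟨i, j, fun σ hσ => (edge_mem_matchingTiles.1 hσ).2⟩
    · exact ⟨i, w, fun σ hσ => by simpa [Equiv.eq_symm_apply] using hσ⟩
    · exact ⟨j, j, fun σ hσ => absurd hσ (by simpa using h)⟩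

theorem exists_matchingSlack_eq_zero (t : MatchingTile n) :
    ∃ x ∈ bipartiteMatchingPolytope n, matchingSlack t x = 0 := by
  rcases t with p | i | j
  · obtain ⟨x, hx, h⟩ := exists_matchingSlack_eq (Equiv.refl (Fin n)) Finset.univ
    exact ⟨x, hx, by simpa using h (.inl p)⟩
  · obtain ⟨x, hx, h⟩ := exists_matchingSlack_eq (Equiv.refl (Fin n)) ∅
    exact ⟨x, hx, by simpa using h (.inr (.inl i))⟩
  · obtain ⟨x, hx, h⟩ := exists_matchingSlack_eq (Equiv.refl (Fin n)) ∅
    exact ⟨x, hx, by simpa using h (.inr (.inr j))⟩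

end Perm

/-! ### The lower bound for extensions -/

/-- The preimage in an extension of a face of the polytope is contained in a facet that avoids a
given point off that face. -/
theorem IsPolytope.exists_isFacet {E : Type*} [AddCommGroup E] [Module ℝ E] {P : Set E} {e : ℕ}
    {Q : Set (Fin e → ℝ)} (hQ : IsPolytope Q) {π : (Fin e → ℝ) →ᵃ[ℝ] E} (hπ : π '' Q = P)
    (s : E →ᵃ[ℝ] ℝ) (hs : ∀ x ∈ P, 0 ≤ s x) (hs0 : ∃ x ∈ P, s x = 0) {q : Fin e → ℝ}
    (hq : q ∈ Q) (hsq : 0 < s (π q)) :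
    ∃ F, IsFacet Q F ∧ (∀ x ∈ Q, s (π x) = 0 → x ∈ F) ∧ q ∉ F := by
  obtain ⟨V, hV, rfl⟩ := hQ
  obtain ⟨_, hx, hx0⟩ := hs0
  rw [← hπ] at hx
  obtain ⟨f, hf, rfl⟩ := hx
  set g := s.comp π with hg
  have hlin : ∀ x, (-g.linear) x = g 0 - g x := fun x => by
    have := g.linearMap_vsub x 0
    simp only [vsub_eq_sub, sub_zero] at this
    rw [LinearMap.neg_apply, this, neg_sub]
  have hg0 : ∀ x ∈ convexHull ℝ V, 0 ≤ g x := fun x hx => hs _ (hπ ▸ Set.mem_image_of_mem π hx)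
  have hgf : g f = 0 := hx0
  have hgq : 0 < g q := hsq
  obtain ⟨F, hF, hsub, hqF⟩ := exists_facet_of_face hV hf hq (-g.linear) (g 0)
    (fun x hx => by rw [hlin]; linarith [hg0 x hx]) (by rw [hlin, hgf, sub_zero])
    (by rw [hlin]; linarith)
  refine ⟨F, hF, fun x hx hx0 => hsub ⟨hx, ?_⟩, hqF⟩
  rw [hlin, show g x = 0 from hx0, sub_zero]

theorem le_numFacets_of_isExtension {n : ℕ} (hn : 4 ≤ n) {e : ℕ} {Q : Set (Fin e → ℝ)}
    (hQ : IsExtension (bipartiteMatchingPolytope n) Q) :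
    ((n ^ 2 + 2 * n : ℕ) : ℕ∞) ≤ numFacets Q := by
  classical
  obtain ⟨hpoly, π, hπ⟩ := hQ
  rcases Set.finite_or_infinite {F | IsFacet Q F} with hfin | hinf
  · have := hfin.fintype
    have hcard := card_matchingTile_le hn (ι := {F | IsFacet Q F})
      (fun F => Finset.univ.filter fun t => ∀ x ∈ Q, matchingSlack t (π x) = 0 → x ∈ F.1) (by
        intro σ S t ht
        obtain ⟨x, hx, hslack⟩ := exists_matchingSlack_eq σ S
        rw [← hπ] at hx
        obtain ⟨q, hq, rfl⟩ := hx
        obtain ⟨F, hF, htF, hqF⟩ := IsPolytope.exists_isFacet hpoly hπ (matchingSlack t)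
          (fun x hx => by rw [bipartiteMatchingPolytope_eq] at hx; exact hx t)
          -- Tiles outside the support have slack zero at `q`; were such a tile in the set of `F`,
          -- then `q` would lie in `F`.
          (exists_matchingSlack_eq_zero t) hq (by rw [hslack, if_pos ht]; exact one_pos)
        refine ⟨⟨F, hF⟩, by simpa using htF, fun t' ht' => ?_⟩
        by_contra hcon
        exact hqF ((Finset.mem_filter.1 ht').2 q hq (by rw [hslack, if_neg hcon])))
    have hT : Fintype.card (MatchingTile n) = n ^ 2 + 2 * n := by
      simp [MatchingTile]
      ring
    rw [numFacets, Set.encard_eq_coe_toFinset_card, Set.toFinset_card, ← hT]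
    exact_mod_cast hcard
  · rw [numFacets, hinf.encard_eq]
    exact le_top

theorem mainTheorem11 (n : ℕ) (hn : 4 ≤ n) :
    extensionComplexity (bipartiteMatchingPolytope n) = ((n ^ 2 + 2 * n : ℕ) : ℕ∞) := by
  refine le_antisymm (extensionComplexity_bipartiteMatchingPolytope_le n) (le_sInf ?_)
  rintro _ ⟨e, Q, hQ, rfl⟩
  exact le_numFacets_of_isExtension hn hQ
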